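/- A channel $W:\mathcal X\to\mathcal P(\mathcal Y)$ is a function from a non-empty input set $\mathcal X$ to the set of probability measures on a measurable space $(\mathcal Y,\mathscr Y)$; neither set needs to be finite. For a probability mass function $P$ on $\mathcal X$ with finite support, put $q_P=\sum_x P(x)W(x)$. For $\alpha>0$ the order $\alpha$ Rényi information is $$I_\alpha(P;W)=\frac{\alpha}{\alpha-1}\ln\int\Big(\sum_x P(x)\Big(\frac{dW(x)}{d\nu}\Big)^{\alpha}\Big)^{1/\alpha}d\nu\quad(\alpha\neq1),\qquad I_1(P;W)=\sum_x P(x)\,D(W(x)\,\|\,q_P),$$ where $\nu$ is any probability measure with $q_P\ll\nu$ (the value does not depend on $\nu$) and $D$ is the Kullback–Leibler divergence. The order $\alpha$ Rényi capacity is $C_{\alpha,W}=\sup_P I_\alpha(P;W)\in[0,\infty]$, the supremum being over all finitely supported $P$. An $(M,L)$ code on $W$, with $M,L\geq1$ integers, consists of an encoder $\Psi:\{1,\dots,M\}\to\mathcal X$ and a measurable decoder $\Theta$ from $\mathcal Y$ to the subsets of $\{1,\dots,M\}$ of size $L$; its average error probability is $P_e=\frac1M\sum_{m=1}^M W(\Psi(m))(\{y: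 m\notin\Theta(y)\})$. Let $(W^{(n)})_n$ be a sequence of channels (the input and output spaces may depend on $n$) and $(t_n)_n$ a sequence of real scaling factors. A sequence of $(M_n,L_n)$ codes on $W^{(n)}$ with average error probabilities $P_e^{(n)}$ is reliable if $P_e^{(n)}\to0$, and is of rate $R\in[-\infty,\infty]$ if $\liminf_{n\to\infty}\frac1{t_n}\ln\frac{M_n}{L_n}=R$. The channel capacity $C(W^{(n)},t_n)$ is the supremum of the rates of the reliable sequences of codes with $L_n=1$ for all $n$. **Theorem.** Let $(W^{(n)})_n$ be any sequence of channels and $(t_n)_n$ a sequence of scaling factors with $\lim_{n\to\infty}t_n=\infty$. (a) If there are $\varepsilon\in(0,1)$ and a lower semicontinuous function $\eta:[1-\varepsilon,1]\to[-\infty,\infty]$ such that $\lim_{n\to\infty}C_{\alpha,W^{(n)}}/t_n=\eta(\alpha)$ for all $\alpha\in[1-\varepsilon,1]$, then $C(W^{(n)},t_n)=\eta(1)$ (the value $\infty$ is allowed). (b) If there are $\varepsilon>0$ and an upper semicontinuous function $\eta:[1,1+\varepsilon]\to[-\infty,\infty]$ with $\eta(1+\varepsilon)<\infty$ such that $\limsup_{n\to\infty}C_{\alpha,W^{(n)}}/t_n=\eta(\alpha)$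 for all $\alpha\in[1,1+\varepsilon]$, then for every $R>\eta(1)$ and every sequence of codes of rate $R$ (with arbitrary list sizes), $\lim_{n\to\infty}P_e^{(n)}=1$. -/

import Mathlib

open Filter Topology Set MeasureTheory
open scoped ENNReal NNReal

namespace ChannelCoding

noncomputable section

/-- A channel with input set `X` and output space `Y`: an arbitrary function from `X` to the
probability measures on `Y`. -/
abbrev Channel (X Y : Type*) [MeasurableSpace Y] := X → ProbabilityMeasure Y

/-- The probability mass functions on `X` that are non-zero only at finitely many points. -/
def FinPMF (X : Type*) := {P : X →₀ ℝ≥0 // ∑ x ∈ P.support, P x = 1}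

section Information

variable {X Y : Type*} [MeasurableSpace Y]

/-- The output distribution `q = ∑ x, P(x) W(x)`, also called the order one Rényi mean. -/
def outputMeasure (P : FinPMF X) (W : Channel X Y) : Measure Y :=
  ∑ x ∈ P.1.support, P.1 x • (W x : Measure Y)

/-- The order `α` Rényi information (`α > 0`) of the input distribution `P`:
for `α ≠ 1` it is `α / (α - 1) * log ∫ (∑ x, P(x) (dW(x)/dq) ^ α) ^ (1/α) dq`, where the reference
measure is `q = ∑ x, P(x) W(x)` (the value is the same for every reference measure that
dominates `q`); for `α = 1` it is the mutual information `∑ x, P(x) D(W(x) ‖ q)`. -/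
def renyiInformation (α : ℝ) (P : FinPMF X) (W : Channel X Y) : EReal :=
  if α = 1 then
    ((∑ x ∈ P.1.support,
      (P.1 x : ℝ≥0∞) * InformationTheory.klDiv (W x : Measure Y) (outputMeasure P W) : ℝ≥0∞) :
        EReal)
  else
    ((α / (α - 1) : ℝ) : EReal) *
      ENNReal.log (∫⁻ y, (∑ x ∈ P.1.support,
        (P.1 x : ℝ≥0∞) * ((W x : Measure Y).rnDeriv (outputMeasure P W) y) ^ α) ^ (1 / α)
          ∂(outputMeasure P W))

/-- The order `α` Rényi capacity, the supremum of the order `α` Rényi information over the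
finitely supported input distributions. -/
def renyiCapacity (α : ℝ) (W : Channel X Y) : EReal :=
  ⨆ P : FinPMF X, renyiInformation α P W

end Information

/-- A channel code with input set `X` and output space `Y`: the message set is `Fin M` and the
decoder is a measurable map to the subsets of the message set of size `L`. -/
structure Code (X Y : Type*) [MeasurableSpace Y] where
  /-- message set size -/
  M : ℕ
  /-- list size -/
  L : ℕ
  M_pos : 0 < M
  L_pos : 0 < L
  /-- encoding function -/
  enc : Fin M → X
  /-- decoding function -/
  dec : Y → Finset (Fin M)
  card_dec : ∀ y, (dec y).card = L
  measurable_dec : Measurable[_, ⊤] dec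

/-- The conditional error probability of the code given the message `m`. -/
def Code.condError {X Y : Type*} [MeasurableSpace Y] (c : Code X Y) (W : Channel X Y)
    (m : Fin c.M) : ℝ :=
  (W (c.enc m) : Measure Y).real {y | m ∉ c.dec y}

/-- The average error probability of the code. -/
def Code.avgError {X Y : Type*} [MeasurableSpace Y] (c : Code X Y) (W : Channel X Y) : ℝ :=
  (1 / (c.M : ℝ)) * ∑ m, c.condError W m

section Sequences

variable {X Y : ℕ → Type*} [∀ n, MeasurableSpace (Y n)]

/-- A sequence of codes is reliable if its average error probability tends to zero. -/
def IsReliable (W : ∀ n, Channel (X n) (Y n)) (c : ∀ n, Code (X n) (Y n)) : Prop :=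
  Tendsto (fun n => (c n).avgError (W n)) atTop (𝓝 0)

/-- A sequence of codes is of rate `R` if `liminf (1 / t n) * log (M n / L n) = R`. -/
def IsOfRate (t : ℕ → ℝ) (c : ∀ n, Code (X n) (Y n)) (R : EReal) : Prop :=
  liminf (fun n => ((1 / t n * Real.log ((c n).M / (c n).L) : ℝ) : EReal)) atTop = R

/-- The channel capacity: the supremum of the rates of the reliable sequences of codes of list
size one. -/
def channelCapacity (W : ∀ n, Channel (X n) (Y n)) (t : ℕ → ℝ) : EReal :=
  sSup {R : EReal | ∃ c : ∀ n, Code (X n) (Y n),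
    (∀ n, (c n).L = 1) ∧ IsReliable W c ∧ IsOfRate t c R}

end Sequences

end

end ChannelCoding

/-!
For a finitely supported input distribution `P` let `q` be the output distribution and
`f x = dW(x)/dq` the likelihood ratio of the input `x`. The asymptotic statements follow from three
bounds on a single code, in each of which the Rényi information appears as an exponent.

Achievability. Feinstein's greedy construction (`exists_code_of_threshold`) gives `M` codewords with
error probability about `P[f ≤ τ] + M / τ`: while the decoding regions used so far have output
probability at most `M / τ`, averaging over `P` finds one more codeword. For `α < 1`, Chernoff's
bound and Jensen's inequality bound `P[f ≤ τ]` by `exp ((1 - α) (log τ - I_α))`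
(`sum_measure_rnDeriv_le_le`). Hence with `I_α > r t` and threshold `exp (s t)`, where `R < s < r`,
the error of `exp (R t)` messages vanishes. Lower semicontinuity of the limit `η` makes every rate
`R < η 1` smaller than some `η α` with `α < 1`.

Weak converse. The variational bound `s μ(A) ≤ D(μ‖ν) + (exp s - 1) ν(A)` with `s = log M`, applied
to the decoding regions and averaged over the messages, is Fano's inequality
`(1 - P_e) log M ≤ I_1 + 1` (`Code.log_mul_one_sub_avgError_le`).

Strong converse. For `α > 1`, Hölder's inequality on each decoded list of size `L` gives Arimoto's
bound `1 - P_e ≤ (L / M) ^ ((α - 1) / α) * exp ((α - 1) / α * I_α)` (`Code.one_sub_avgError_le`).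
Upper semicontinuity of `η` makes a rate above `η 1` also exceed `η α` for some `α > 1`, and then
the bound decays exponentially in `t`.

In both converses the input distribution is uniform on the codewords (`Code.inputPMF`).
-/

namespace ChannelCoding

/-! ### The output measure and uniform input distributions -/

section OneShot

variable {X Y : Type*} [MeasurableSpace Y]

lemma FinPMF.sum_coe (P : FinPMF X) : ∑ x ∈ P.1.support, (P.1 x : ℝ≥0∞) = 1 := by
  exact_mod_cast congrArg ((↑) : ℝ≥0 → ℝ≥0∞) P.2

lemma outputMeasure_apply (P : FinPMF X) (W : Channel X Y) (A : Set Y) :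
    outputMeasure P W A = ∑ x ∈ P.1.support, (P.1 x : ℝ≥0∞) * (W x : Measure Y) A := by
  simp only [outputMeasure, Measure.finsetSum_apply, Measure.smul_apply, ENNReal.smul_def,
    smul_eq_mul]

instance isProbabilityMeasure_outputMeasure (P : FinPMF X) (W : Channel X Y) :
    IsProbabilityMeasure (outputMeasure P W) :=
  ⟨by simp [outputMeasure_apply, P.sum_coe]⟩

lemma absolutelyContinuous_outputMeasure (P : FinPMF X) (W : Channel X Y) {x : X}
    (hx : x ∈ P.1.support) : (W x : Measure Y) ≪ outputMeasure P W := by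
  intro A hA
  rw [outputMeasure_apply, Finset.sum_eq_zero_iff] at hA
  simpa [Finsupp.mem_support_iff.1 hx] using hA x hx

/-- The distribution of `enc m` for `m` uniform on `Fin M`. Different messages may share a
codeword, whose masses then add up. -/
noncomputable def FinPMF.uniformOn {M : ℕ} (hM : 0 < M) (enc : Fin M → X) : FinPMF X :=
  ⟨∑ m, Finsupp.single (enc m) (M : ℝ≥0)⁻¹, by
    have h := Finsupp.sum_finsetSum_index (s := Finset.univ)
      (g := fun m : Fin M => Finsupp.single (enc m) (M : ℝ≥0)⁻¹) (h := fun _ (c : ℝ≥0) => c)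
      (by simp) (by simp)
    have hM' : (M : ℝ≥0) ≠ 0 := by positivity
    simpa [Finsupp.sum, hM'] using h.symm⟩

lemma FinPMF.sum_uniformOn {M : ℕ} (hM : 0 < M) (enc : Fin M → X) (g : X → ℝ≥0∞) :
    ∑ x ∈ (uniformOn hM enc).1.support, ((uniformOn hM enc).1 x : ℝ≥0∞) * g x
      = ∑ m, (M : ℝ≥0∞)⁻¹ * g (enc m) := by
  have h := Finsupp.sum_finsetSum_index (s := Finset.univ)
    (g := fun m : Fin M => Finsupp.single (enc m) (M : ℝ≥0)⁻¹)
    (h := fun x (c : ℝ≥0) => (c : ℝ≥0∞) * g x) (by simp) (by simp [add_mul])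
  have hM' : (M : ℝ≥0) ≠ 0 := by positivity
  rw [Finset.sum_congr rfl fun m _ => Finsupp.sum_single_index (by simp)] at h
  simpa [Finsupp.sum, uniformOn, ENNReal.coe_inv hM'] using h.symm

lemma FinPMF.mem_support_uniformOn {M : ℕ} (hM : 0 < M) (enc : Fin M → X) (m : Fin M) :
    enc m ∈ (uniformOn hM enc).1.support := by
  have hM' : (M : ℝ≥0)⁻¹ ≠ 0 := by positivity
  rw [Finsupp.mem_support_iff, uniformOn, Finsupp.finsetSum_apply]
  intro h
  exact hM' (by simpa using (Finset.sum_eq_zero_iff.1 h) m (Finset.mem_univ m))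

/-! ### Codes -/

lemma Code.measurableSet_mem_dec (c : Code X Y) (m : Fin c.M) :
    MeasurableSet {y | m ∈ c.dec y} :=
  c.measurable_dec (t := {s | m ∈ s}) trivial

lemma Code.avgError_nonneg (c : Code X Y) (W : Channel X Y) : 0 ≤ c.avgError W :=
  mul_nonneg (by positivity) (Finset.sum_nonneg fun _ _ => measureReal_nonneg)

/-- The average probability of correct decoding, as an extended nonnegative real. -/
lemma Code.ofReal_one_sub_avgError (c : Code X Y) (W : Channel X Y) :
    ENNReal.ofReal (1 - c.avgError W)
      = ∑ m, (c.M : ℝ≥0∞)⁻¹ * (W (c.enc m) : Measure Y) {y | m ∈ c.dec y} := by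
  have hM : (0 : ℝ) < c.M := by exact_mod_cast c.M_pos
  have h : 1 - c.avgError W
      = ∑ m, (c.M : ℝ)⁻¹ * (W (c.enc m) : Measure Y).real {y | m ∈ c.dec y} := by
    have h1 (m : Fin c.M) : c.condError W m
        = 1 - (W (c.enc m) : Measure Y).real {y | m ∈ c.dec y} := by
      rw [← probReal_compl_eq_one_sub (c.measurableSet_mem_dec m)]
      rfl
    rw [Code.avgError, Finset.sum_congr rfl fun m _ => h1 m, ← Finset.mul_sum,
      Finset.sum_sub_distrib]
    simp
    field_simp
    ring
  rw [h, ENNReal.ofReal_sum_of_nonneg (fun m _ => by positivity)]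
  refine Finset.sum_congr rfl fun m _ => ?_
  rw [ENNReal.ofReal_mul (by positivity), ENNReal.ofReal_inv_of_pos hM, ENNReal.ofReal_natCast,
    ofReal_measureReal]

/-! ### Feinstein's maximal coding lemma -/

lemma measure_lt_rnDeriv_le (μ ν : Measure Y) [IsProbabilityMeasure μ] {τ : ℝ≥0∞}
    (hτ : τ ≠ 0) (hτ' : τ ≠ ⊤) : ν {y | τ < μ.rnDeriv ν y} ≤ τ⁻¹ := by
  have h := meas_ge_le_lintegral_div (μ := ν) (Measure.measurable_rnDeriv μ ν).aemeasurable hτ hτ'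
  calc ν {y | τ < μ.rnDeriv ν y} ≤ ν {y | τ ≤ μ.rnDeriv ν y} :=
        measure_mono fun y (hy : τ < _) => hy.le
    _ ≤ _ := h
    _ ≤ μ univ / τ := by gcongr; exact Measure.lintegral_rnDeriv_le
    _ = τ⁻¹ := by simp

/-- The greedy step: as long as the decoding region `E` already used has output probability at
most `κ`, averaging over `P` shows that some input decodes well off `E`. -/
lemma exists_input_off (P : FinPMF X) (W : Channel X Y) {τ κ δ : ℝ≥0∞}
    (hδ : ∑ x ∈ P.1.support, (P.1 x : ℝ≥0∞) *
      (W x : Measure Y) {y | (W x : Measure Y).rnDeriv (outputMeasure P W) y ≤ τ} + κ < δ)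
    {E : Set Y} (hE : outputMeasure P W E ≤ κ) :
    ∃ x, 1 ≤ (W x : Measure Y)
      ({y | τ < (W x : Measure Y).rnDeriv (outputMeasure P W) y} \ E) + δ := by
  by_contra! hcon
  set q := outputMeasure P W
  set A : X → Set Y := fun x => {y | (W x : Measure Y).rnDeriv q y ≤ τ}
  have h1 (x : X) : 1 + δ ≤ (W x : Measure Y) (A x) + (W x : Measure Y) E + 1 := by
    have hcov : (univ : Set Y) ⊆
        A x ∪ E ∪ ({y | τ < (W x : Measure Y).rnDeriv q y} \ E) := by
      intro y _
      by_cases hy : y ∈ E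
      · simp [hy]
      · simp [A, hy, le_or_gt]
    calc 1 + δ = (W x : Measure Y) univ + δ := by simp
      _ ≤ (W x : Measure Y) (A x) + (W x : Measure Y) E
          + (W x : Measure Y) ({y | τ < (W x : Measure Y).rnDeriv q y} \ E) + δ := by
        gcongr
        exact (measure_mono hcov).trans <| (measure_union_le _ _).trans <| by
          gcongr; exact measure_union_le _ _
      _ ≤ _ := by rw [add_assoc]; gcongr; exact (hcon x).le
  have h2 : 1 + δ ≤ (∑ x ∈ P.1.support, (P.1 x : ℝ≥0∞) * (W x : Measure Y) (A x)) + q E + 1 := by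
    calc 1 + δ = ∑ x ∈ P.1.support, (P.1 x : ℝ≥0∞) * (1 + δ) := by
          rw [← Finset.sum_mul, P.sum_coe, one_mul]
      _ ≤ ∑ x ∈ P.1.support, (P.1 x : ℝ≥0∞) *
          ((W x : Measure Y) (A x) + (W x : Measure Y) E + 1) := by
        exact Finset.sum_le_sum fun x _ => mul_le_mul_right (h1 x) _
      _ = _ := by
        simp_rw [mul_add, Finset.sum_add_distrib, mul_one, P.sum_coe]
        rw [← outputMeasure_apply]
  rw [add_comm] at h2
  have h3 := (ENNReal.add_le_add_iff_right ENNReal.one_ne_top).1 h2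
  exact absurd (h3.trans (add_le_add_right hE _)) (not_le.2 hδ)

/-- Feinstein's lemma. A code of size `M` whose conditional error probabilities are at most `δ`
exists once `δ` exceeds the probability that the likelihood ratio `dW(x)/dq` is at most `τ`
plus `M / τ`. -/
theorem exists_code_of_threshold (P : FinPMF X) (W : Channel X Y) {τ δ : ℝ≥0∞}
    (hτ : τ ≠ 0) (hτ' : τ ≠ ⊤) (hδ' : δ ≠ ⊤) {M : ℕ} (hM : 0 < M)
    (hδ : ∑ x ∈ P.1.support, (P.1 x : ℝ≥0∞) *
      (W x : Measure Y) {y | (W x : Measure Y).rnDeriv (outputMeasure P W) y ≤ τ}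
        + M * τ⁻¹ < δ) :
    ∃ c : Code X Y, c.M = M ∧ c.L = 1 ∧ c.avgError W ≤ δ.toReal := by
  classical
  set q := outputMeasure P W
  have key (k : ℕ) (hk : k ≤ M) : ∃ (x : ℕ → X) (D : ℕ → Set Y), (∀ i < k, MeasurableSet (D i)) ∧
      (∀ i < k, ∀ j < k, i ≠ j → Disjoint (D i) (D j)) ∧ (∀ i < k, q (D i) ≤ τ⁻¹) ∧
      ∀ i < k, 1 ≤ (W (x i) : Measure Y) (D i) + δ := by
    induction k with
    | zero =>
      obtain ⟨x, -⟩ := exists_input_off P W hδ (E := ∅) (by simp)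
      exact ⟨fun _ => x, fun _ => ∅, by simp⟩
    | succ k ih =>
      obtain ⟨x, D, hmeas, hdisj, hq, hW⟩ := ih (by omega)
      set E : Set Y := ⋃ i ∈ Finset.range k, D i
      have hE : q E ≤ M * τ⁻¹ := by
        calc q E ≤ ∑ i ∈ Finset.range k, q (D i) := measure_biUnion_finset_le _ _
          _ ≤ ∑ i ∈ Finset.range k, τ⁻¹ :=
            Finset.sum_le_sum fun i hi => hq i (Finset.mem_range.1 hi)
          _ = k * τ⁻¹ := by simp
          _ ≤ M * τ⁻¹ := by gcongr; omega
      have hEm : MeasurableSet E :=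
        Finset.measurableSet_biUnion _ fun i hi => hmeas i (Finset.mem_range.1 hi)
      obtain ⟨z, hz⟩ := exists_input_off P W hδ hE
      set F : Set Y := {y | τ < (W z : Measure Y).rnDeriv q y} \ E
      have hDF (i : ℕ) (hi : i < k) : Disjoint (D i) F :=
        disjoint_sdiff_right.mono_left
          (subset_biUnion_of_mem (u := D) (Finset.mem_coe.2 (Finset.mem_range.2 hi)))
      refine ⟨Function.update x k z, Function.update D k F, ?_, ?_, ?_, ?_⟩
      · intro i hi
        rcases Nat.lt_succ_iff_lt_or_eq.1 hi with h | rfl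
        · simpa [h.ne] using hmeas i h
        · simpa using (measurableSet_lt measurable_const
            (Measure.measurable_rnDeriv _ _)).diff hEm
      · intro i hi j hj hij
        rcases Nat.lt_succ_iff_lt_or_eq.1 hi with h | rfl <;>
          rcases Nat.lt_succ_iff_lt_or_eq.1 hj with h' | rfl
        · simpa [h.ne, h'.ne] using hdisj i h j h' hij
        · simpa [h.ne] using hDF i h
        · simpa [h'.ne] using (hDF j h').symm
        · exact absurd rfl hij
      · intro i hi
        rcases Nat.lt_succ_iff_lt_or_eq.1 hi with h | rfl
        · simpa [h.ne] using hq i h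
        · simpa using (measure_mono sdiff_subset).trans (measure_lt_rnDeriv_le _ q hτ hτ')
      · intro i hi
        rcases Nat.lt_succ_iff_lt_or_eq.1 hi with h | rfl
        · simpa [h.ne] using hW i h
        · simpa using hz
  obtain ⟨x, D, hmeas, hdisj, -, hW⟩ := key M le_rfl
  have : Nonempty (Fin M) := ⟨⟨0, hM⟩⟩
  -- outside the union of the disjoint regions `D i` the decoder's value does not matter
  obtain ⟨g, hg, hgD⟩ := exists_measurable_piecewise (β := Fin M)
    (fun i : Fin M => D i) (fun i => hmeas i i.2) (fun i _ => i) (fun i => measurable_const)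
    (by
      intro i j hij y hy
      exact absurd hy ((disjoint_iff_inter_eq_empty.1
        (hdisj i i.2 j j.2 (Fin.val_ne_of_ne hij))) ▸ notMem_empty y))
  let c : Code X Y :=
    { M := M, L := 1, M_pos := hM, L_pos := one_pos
      enc := fun i => x i
      dec := fun y => {g y}
      card_dec := by simp
      measurable_dec := fun s _ => hg (t := {i | ({i} : Finset (Fin M)) ∈ s}) .of_discrete }
  refine ⟨c, rfl, rfl, ?_⟩
  have hc (m : Fin M) : c.condError W m ≤ δ.toReal := by
    have hsub : {y | m ∉ c.dec y} ⊆ (D m)ᶜ := by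
      intro y hy hyD
      exact hy (by simp [c, hgD m hyD])
    refine ENNReal.toReal_mono hδ' ((measure_mono hsub).trans ?_)
    rw [prob_compl_eq_one_sub (hmeas m m.2), tsub_le_iff_left]
    exact hW m m.2
  have hM' : (0 : ℝ) < M := by exact_mod_cast hM
  calc c.avgError W ≤ (1 / (M : ℝ)) * ∑ _m : Fin M, δ.toReal :=
        mul_le_mul_of_nonneg_left (Finset.sum_le_sum fun m _ => hc m) (by positivity)
    _ = δ.toReal := by simp; field_simp

/-! ### Rényi information as an exponent -/

/-- The integral whose logarithm defines the Rényi information of order `α ≠ 1`. -/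
noncomputable def renyiIntegral (α : ℝ) (P : FinPMF X) (W : Channel X Y) : ℝ≥0∞ :=
  ∫⁻ y, (∑ x ∈ P.1.support,
    (P.1 x : ℝ≥0∞) * ((W x : Measure Y).rnDeriv (outputMeasure P W) y) ^ α) ^ (1 / α)
      ∂(outputMeasure P W)

lemma renyiInformation_of_ne_one {α : ℝ} (hα : α ≠ 1) (P : FinPMF X) (W : Channel X Y) :
    renyiInformation α P W = ((α / (α - 1) : ℝ) : EReal) * ENNReal.log (renyiIntegral α P W) :=
  if_neg hα

lemma _root_.ENNReal.le_ofReal_exp_of_log_le {J : ℝ≥0∞} {r : ℝ} (h : ENNReal.log J ≤ r) :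
    J ≤ ENNReal.ofReal (Real.exp r) := by
  rw [← EReal.exp_coe, ← ENNReal.exp_log J]
  exact EReal.exp_monotone h

lemma renyiIntegral_le_of_information_le {α r : ℝ} (hα : 1 < α) {P : FinPMF X}
    {W : Channel X Y} (h : renyiInformation α P W ≤ r) :
    renyiIntegral α P W ≤ ENNReal.ofReal (Real.exp ((α - 1) / α * r)) := by
  have hc : 0 < α / (α - 1) := div_pos (by linarith) (by linarith)
  rw [renyiInformation_of_ne_one hα.ne', mul_comm,
    ← EReal.le_div_iff_mul_le (by exact_mod_cast hc) (EReal.coe_ne_top _)] at h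
  refine ENNReal.le_ofReal_exp_of_log_le (h.trans_eq ?_)
  rw [← EReal.coe_div]
  congr 1
  have : α - 1 ≠ 0 := by linarith
  field_simp

lemma renyiIntegral_le_of_lt_information {α r : ℝ} (hα0 : 0 < α) (hα : α < 1) {P : FinPMF X}
    {W : Channel X Y} (h : r < renyiInformation α P W) :
    renyiIntegral α P W ≤ ENNReal.ofReal (Real.exp ((α - 1) / α * r)) := by
  have hc : 0 < α / (1 - α) := div_pos hα0 (by linarith)
  have hneg : α / (α - 1) = -(α / (1 - α)) := by rw [← div_neg, neg_sub]
  rw [renyiInformation_of_ne_one hα.ne, hneg, EReal.coe_neg, EReal.neg_mul, EReal.lt_neg_comm,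
    mul_comm] at h
  have h' := (EReal.le_div_iff_mul_le (by exact_mod_cast hc) (EReal.coe_ne_top _)).2 h.le
  refine ENNReal.le_ofReal_exp_of_log_le (h'.trans_eq ?_)
  rw [← EReal.coe_neg, ← EReal.coe_div]
  congr 1
  have : 1 - α ≠ 0 := by linarith
  field_simp
  ring

/-! ### The information spectrum below capacity -/

/-- Chernoff's bound followed by Jensen's inequality: for orders below one the Rényi information
controls the probability that the likelihood ratio `dW(x)/dq` is small. -/
lemma sum_measure_rnDeriv_le_le {α : ℝ} (hα0 : 0 < α) (hα : α < 1) (P : FinPMF X)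
    (W : Channel X Y) (τ : ℝ≥0∞) :
    ∑ x ∈ P.1.support, (P.1 x : ℝ≥0∞) *
      (W x : Measure Y) {y | (W x : Measure Y).rnDeriv (outputMeasure P W) y ≤ τ}
        ≤ τ ^ (1 - α) * renyiIntegral α P W ^ α := by
  set q := outputMeasure P W
  set f : X → Y → ℝ≥0∞ := fun x => (W x : Measure Y).rnDeriv q
  have hf (x : X) : Measurable (f x) := Measure.measurable_rnDeriv _ _
  have h1 (x : X) (hx : x ∈ P.1.support) :
      (W x : Measure Y) {y | f x y ≤ τ} ≤ τ ^ (1 - α) * ∫⁻ y, f x y ^ α ∂q := by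
    have hm : MeasurableSet {y | f x y ≤ τ} := measurableSet_le (hf x) measurable_const
    rw [← Measure.setLIntegral_rnDeriv (absolutelyContinuous_outputMeasure P W hx),
      ← lintegral_const_mul _ ((hf x).pow_const _)]
    refine (setLIntegral_mono ((measurable_const.mul ((hf x).pow_const α)))
      fun y (hy : f x y ≤ τ) => ?_).trans (setLIntegral_le_lintegral _ _)
    calc f x y = f x y ^ (1 - α) * f x y ^ α := by
          rw [← ENNReal.rpow_add_of_nonneg _ _ (by linarith) hα0.le]; simp
      _ ≤ τ ^ (1 - α) * f x y ^ α := by gcongr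
  set G : Y → ℝ≥0∞ := fun y => ∑ x ∈ P.1.support, (P.1 x : ℝ≥0∞) * f x y ^ α
  have hG : Measurable G :=
    Finset.measurable_fun_sum _ fun x _ => ((hf x).pow_const α).const_mul _
  have hJensen : ∫⁻ y, G y ∂q ≤ renyiIntegral α P W ^ α := by
    have h := ENNReal.lintegral_mul_norm_pow_le (μ := q) (f := fun y => G y ^ (1 / α))
      (g := fun _ => 1) (p := α) (q := 1 - α) (hG.pow_const _).aemeasurable
      aemeasurable_const hα0.le (by linarith) (by ring)
    simpa [← ENNReal.rpow_mul, hα0.ne', renyiIntegral] using h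
  calc ∑ x ∈ P.1.support, (P.1 x : ℝ≥0∞) * (W x : Measure Y) {y | f x y ≤ τ}
      ≤ ∑ x ∈ P.1.support, (P.1 x : ℝ≥0∞) * (τ ^ (1 - α) * ∫⁻ y, f x y ^ α ∂q) :=
        Finset.sum_le_sum fun x hx => mul_le_mul_right (h1 x hx) _
    _ = τ ^ (1 - α) * ∫⁻ y, G y ∂q := by
        rw [lintegral_finsetSum _ fun x _ => ((hf x).pow_const α).const_mul _, Finset.mul_sum]
        refine Finset.sum_congr rfl fun x _ => ?_
        rw [lintegral_const_mul _ ((hf x).pow_const _)]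
        ring
    _ ≤ _ := by gcongr

/-! ### Converse bounds for a single code -/

/-- Young's inequality for the convex function `klFun`, whose conjugate is `exp s - 1`. -/
lemma mul_le_klFun_add {s x : ℝ} (hx : 0 ≤ x) :
    s * x ≤ InformationTheory.klFun x + (Real.exp s - 1) := by
  rw [InformationTheory.klFun_apply]
  rcases hx.eq_or_lt with rfl | hx
  · simpa using (Real.exp_pos s).le
  · have h := Real.add_one_le_exp (s - Real.log x)
    have he : Real.exp s = x * Real.exp (s - Real.log x) := by
      rw [Real.exp_sub, Real.exp_log hx]
      field_simp
    rw [he]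
    nlinarith [mul_le_mul_of_nonneg_left h hx.le]

/-- The variational lower bound on the divergence for the test function `s • 1_A`. -/
lemma mul_measure_le_klDiv_add {μ ν : Measure Y} [IsProbabilityMeasure μ]
    [IsProbabilityMeasure ν] (hμν : μ ≪ ν) {s : ℝ} (hs : 0 ≤ s) {A : Set Y} :
    ENNReal.ofReal s * μ A
      ≤ InformationTheory.klDiv μ ν + ENNReal.ofReal (Real.exp s - 1) * ν A := by
  have hf := Measure.measurable_rnDeriv μ ν
  have hk : Measurable fun y => ENNReal.ofReal (InformationTheory.klFun (μ.rnDeriv ν y).toReal) :=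
    (InformationTheory.measurable_klFun.comp hf.ennreal_toReal).ennreal_ofReal
  rw [← Measure.setLIntegral_rnDeriv hμν, ← lintegral_const_mul _ hf,
    InformationTheory.klDiv_eq_lintegral_klFun_of_ac hμν]
  calc ∫⁻ y in A, ENNReal.ofReal s * μ.rnDeriv ν y ∂ν
      ≤ ∫⁻ y in A, (ENNReal.ofReal (InformationTheory.klFun (μ.rnDeriv ν y).toReal)
          + ENNReal.ofReal (Real.exp s - 1)) ∂ν := by
        refine lintegral_mono_ae (ae_restrict_of_ae ?_)
        filter_upwards [Measure.rnDeriv_lt_top μ ν] with y hy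
        rw [← ENNReal.ofReal_add (InformationTheory.klFun_nonneg ENNReal.toReal_nonneg)
          (by linarith [Real.one_le_exp hs])]
        nth_rw 1 [← ENNReal.ofReal_toReal hy.ne]
        rw [← ENNReal.ofReal_mul hs]
        exact ENNReal.ofReal_le_ofReal (mul_le_klFun_add ENNReal.toReal_nonneg)
    _ = ∫⁻ y in A, ENNReal.ofReal (InformationTheory.klFun (μ.rnDeriv ν y).toReal) ∂ν
          + ENNReal.ofReal (Real.exp s - 1) * ν A := by
        rw [lintegral_add_left hk]
        simp
    _ ≤ _ := by gcongr; exact Measure.restrict_le_self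

/-- Every output is decoded to exactly `L` messages. -/
lemma Code.sum_measure_mem_dec (c : Code X Y) (ν : Measure Y) [IsProbabilityMeasure ν] :
    ∑ m, ν {y | m ∈ c.dec y} = c.L := by
  classical
  have h (m : Fin c.M) : ν {y | m ∈ c.dec y} = ∫⁻ y, if m ∈ c.dec y then 1 else 0 ∂ν := by
    rw [← lintegral_indicator_one (c.measurableSet_mem_dec m)]
    simp [indicator_apply]
  rw [Finset.sum_congr rfl fun m _ => h m, ← lintegral_finsetSum]
  · simp [c.card_dec]
  · exact fun m _ => Measurable.ite (c.measurableSet_mem_dec m) measurable_const measurable_const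

/-- The uniform distribution on the codewords of a code. -/
noncomputable def Code.inputPMF (c : Code X Y) : FinPMF X := FinPMF.uniformOn c.M_pos c.enc

/-- A form of Fano's inequality, with the binary entropy term replaced by one. -/
theorem Code.log_mul_one_sub_avgError_le (c : Code X Y) (hL : c.L = 1) (W : Channel X Y) :
    ((Real.log c.M * (1 - c.avgError W) : ℝ) : EReal)
      ≤ renyiInformation 1 c.inputPMF W + 1 := by
  set q := outputMeasure c.inputPMF W
  have hM : (0 : ℝ) < c.M := by exact_mod_cast c.M_pos
  have hlog : 0 ≤ Real.log c.M := Real.log_nonneg (by exact_mod_cast c.M_pos)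
  have hM0 : (c.M : ℝ≥0∞) ≠ 0 := by simpa using c.M_pos.ne'
  have hmain : ENNReal.ofReal (Real.log c.M) * ENNReal.ofReal (1 - c.avgError W)
      ≤ ∑ x ∈ c.inputPMF.1.support,
        (c.inputPMF.1 x : ℝ≥0∞) * InformationTheory.klDiv (W x : Measure Y) q + 1 := by
    rw [c.ofReal_one_sub_avgError, Code.inputPMF, FinPMF.sum_uniformOn, Finset.mul_sum]
    calc ∑ m, ENNReal.ofReal (Real.log c.M) *
          ((c.M : ℝ≥0∞)⁻¹ * (W (c.enc m) : Measure Y) {y | m ∈ c.dec y})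
        ≤ ∑ m, ((c.M : ℝ≥0∞)⁻¹ * InformationTheory.klDiv (W (c.enc m) : Measure Y) q
            + q {y | m ∈ c.dec y}) := by
          refine Finset.sum_le_sum fun m _ => ?_
          have h := mul_measure_le_klDiv_add (absolutelyContinuous_outputMeasure c.inputPMF W
            (FinPMF.mem_support_uniformOn c.M_pos c.enc m)) hlog (A := {y | m ∈ c.dec y})
          have hexp : ENNReal.ofReal (Real.exp (Real.log c.M) - 1) ≤ c.M := by
            rw [Real.exp_log hM, ← ENNReal.ofReal_natCast]
            exact ENNReal.ofReal_le_ofReal (by linarith)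
          calc _ = (c.M : ℝ≥0∞)⁻¹ * (ENNReal.ofReal (Real.log c.M)
                * (W (c.enc m) : Measure Y) {y | m ∈ c.dec y}) := by ring
            _ ≤ (c.M : ℝ≥0∞)⁻¹ * (InformationTheory.klDiv (W (c.enc m) : Measure Y) q
                + c.M * q {y | m ∈ c.dec y}) := by
              gcongr
              exact h.trans (by gcongr)
            _ = _ := by
              rw [mul_add, ← mul_assoc _ (c.M : ℝ≥0∞),
                ENNReal.inv_mul_cancel hM0 (ENNReal.natCast_ne_top _), one_mul]
      _ = _ := by
          rw [Finset.sum_add_distrib, c.sum_measure_mem_dec q, hL, Nat.cast_one]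
  rw [renyiInformation, if_pos rfl]
  calc ((Real.log c.M * (1 - c.avgError W) : ℝ) : EReal)
      ≤ ((ENNReal.ofReal (Real.log c.M * (1 - c.avgError W)) : ℝ≥0∞) : EReal) := by
        rw [EReal.coe_ennreal_ofReal]
        exact_mod_cast le_max_left _ _
    _ ≤ _ := by
        rw [ENNReal.ofReal_mul hlog]
        exact_mod_cast hmain

/-- Arimoto's strong converse bound, by Hölder's inequality on each decoded list. -/
theorem Code.one_sub_avgError_le (c : Code X Y) (W : Channel X Y) {α : ℝ} (hα : 1 < α) :
    ENNReal.ofReal (1 - c.avgError W)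
      ≤ ((c.L : ℝ≥0∞) * (c.M : ℝ≥0∞)⁻¹) ^ (1 - 1 / α) * renyiIntegral α c.inputPMF W := by
  classical
  set q := outputMeasure c.inputPMF W
  set f : Fin c.M → Y → ℝ≥0∞ := fun m => (W (c.enc m) : Measure Y).rnDeriv q
  have hf (m : Fin c.M) : Measurable (f m) := Measure.measurable_rnDeriv _ _
  have hα0 : 0 < α := by linarith
  have hinv : (c.M : ℝ≥0∞)⁻¹ ≠ ⊤ := by simpa using c.M_pos.ne'
  have hinv0 : (c.M : ℝ≥0∞)⁻¹ ≠ 0 := by simp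
  have hβ : α.HolderConjugate (1 - 1 / α)⁻¹ := by
    rw [Real.holderConjugate_iff]
    exact ⟨hα, by field_simp; ring⟩
  have hβ0 : 1 - 1 / α ≠ 0 := by
    have : 1 / α < 1 := by rw [div_lt_one hα0]; exact hα
    linarith
  have hsum (m : Fin c.M) : (c.M : ℝ≥0∞)⁻¹ * (W (c.enc m) : Measure Y) {y | m ∈ c.dec y}
      = ∫⁻ y, (if m ∈ c.dec y then (c.M : ℝ≥0∞)⁻¹ * f m y else 0) ∂q := by
    rw [← Measure.setLIntegral_rnDeriv (absolutelyContinuous_outputMeasure c.inputPMF W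
        (FinPMF.mem_support_uniformOn c.M_pos c.enc m)),
      ← lintegral_const_mul _ (hf m), ← lintegral_indicator (c.measurableSet_mem_dec m)]
    simp only [indicator_apply, mem_ofPred_eq]
    rfl
  have hpt (y : Y) : ∑ m, (if m ∈ c.dec y then (c.M : ℝ≥0∞)⁻¹ * f m y else 0)
      ≤ ((c.L : ℝ≥0∞) * (c.M : ℝ≥0∞)⁻¹) ^ (1 - 1 / α)
        * (∑ m, (c.M : ℝ≥0∞)⁻¹ * f m y ^ α) ^ (1 / α) := by
    -- the weight `M⁻¹` is shared between the factors so that the first norm is that of the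
    -- Rényi integrand and the second is `(L / M) ^ (1 - 1 / α)`
    have h := ENNReal.inner_le_Lp_mul_Lq (c.dec y)
      (fun m => (c.M : ℝ≥0∞)⁻¹ ^ (1 / α) * f m y) (fun _ => (c.M : ℝ≥0∞)⁻¹ ^ (1 - 1 / α)) hβ
    have hl (m : Fin c.M) : (c.M : ℝ≥0∞)⁻¹ ^ (1 / α) * f m y * (c.M : ℝ≥0∞)⁻¹ ^ (1 - 1 / α)
        = (c.M : ℝ≥0∞)⁻¹ * f m y := by
      rw [mul_right_comm, ← ENNReal.rpow_add _ _ hinv0 hinv]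
      simp
    have hr (m : Fin c.M) : ((c.M : ℝ≥0∞)⁻¹ ^ (1 / α) * f m y) ^ α
        = (c.M : ℝ≥0∞)⁻¹ * f m y ^ α := by
      rw [ENNReal.mul_rpow_of_nonneg _ _ hα0.le, ← ENNReal.rpow_mul, one_div_mul_cancel hα0.ne',
        ENNReal.rpow_one]
    simp only [hl, hr, ← ENNReal.rpow_mul, mul_inv_cancel₀ hβ0, ENNReal.rpow_one,
      Finset.sum_const, c.card_dec, nsmul_eq_mul, one_div (1 - 1 / α)⁻¹, inv_inv] at h
    rw [Finset.sum_ite_mem, Finset.univ_inter, mul_comm]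
    refine h.trans ?_
    gcongr
    exact Finset.subset_univ _
  rw [c.ofReal_one_sub_avgError, Finset.sum_congr rfl fun m _ => hsum m, ← lintegral_finsetSum]
  swap
  · exact fun m _ => Measurable.ite (c.measurableSet_mem_dec m) ((hf m).const_mul _)
      measurable_const
  refine (lintegral_mono hpt).trans_eq ?_
  rw [lintegral_const_mul _
    ((Finset.measurable_fun_sum _ fun m _ => ((hf m).pow_const α).const_mul _).pow_const _),
    renyiIntegral]
  congr 1
  refine lintegral_congr fun y => ?_
  rw [Code.inputPMF, FinPMF.sum_uniformOn]
  rfl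

/-! ### Exponential bounds for a single channel -/

lemma Code.avgError_le_one (c : Code X Y) (W : Channel X Y) : c.avgError W ≤ 1 := by
  have hM : (0 : ℝ) < c.M := by exact_mod_cast c.M_pos
  calc c.avgError W ≤ (1 / (c.M : ℝ)) * ∑ _m : Fin c.M, (1 : ℝ) :=
        mul_le_mul_of_nonneg_left (Finset.sum_le_sum fun m _ => measureReal_le_one)
          (by positivity)
    _ = 1 := by simp; field_simp

/-- The code with a single message. -/
def Code.trivial (x : X) : Code X Y where
  M := 1
  L := 1
  M_pos := one_pos
  L_pos := one_pos
  enc := fun _ => x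
  dec := fun _ => {0}
  card_dec := fun _ => rfl
  measurable_dec := @measurable_const _ _ ⊤ _ _

lemma Code.avgError_trivial (x : X) (W : Channel X Y) : (Code.trivial x).avgError W = 0 := by
  have h (m : Fin (Code.trivial (Y := Y) x).M) : (Code.trivial (Y := Y) x).condError W m = 0 := by
    have hempty : {y : Y | m ∉ (Code.trivial (Y := Y) x).dec y} = ∅ :=
      eq_empty_of_forall_notMem fun y hy => hy (Finset.mem_singleton.2 (Fin.fin_one_eq_zero m))
    rw [Code.condError, hempty, measureReal_empty]
  rw [Code.avgError, Finset.sum_eq_zero fun m _ => h m, mul_zero]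

lemma renyiInformation_one_nonneg (P : FinPMF X) (W : Channel X Y) :
    0 ≤ renyiInformation 1 P W := by
  rw [renyiInformation, if_pos rfl]
  exact EReal.coe_ennreal_nonneg _

lemma renyiCapacity_one_nonneg [Nonempty X] (W : Channel X Y) : 0 ≤ renyiCapacity 1 W :=
  (renyiInformation_one_nonneg (Code.trivial (Y := Y) (Classical.arbitrary X)).inputPMF W).trans
    (le_iSup (fun P => renyiInformation 1 P W) _)

/-- Achievability for a single channel: `exp ρ` messages at Rényi information above `r`, decoded
with the likelihood threshold `exp s`. The slack `e` is there because Feinstein's lemma needs a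
strict inequality. -/
theorem exists_code_of_lt_renyiInformation {α r ρ e : ℝ} (s : ℝ) (hα0 : 0 < α) (hα : α < 1)
    (hρ : 0 ≤ ρ) (he : 0 < e) {P : FinPMF X} {W : Channel X Y}
    (h : r < renyiInformation α P W) :
    ∃ c : Code X Y, c.M = ⌈Real.exp ρ⌉₊ ∧ c.L = 1 ∧
      c.avgError W ≤ Real.exp ((1 - α) * (s - r)) + 2 * Real.exp (ρ - s) + e := by
  have hτ : ENNReal.ofReal (Real.exp s) ≠ 0 := by simpa using Real.exp_pos s
  have h1 := sum_measure_rnDeriv_le_le hα0 hα P W (ENNReal.ofReal (Real.exp s))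
  have h2 : ENNReal.ofReal (Real.exp s) ^ (1 - α) * renyiIntegral α P W ^ α
      ≤ ENNReal.ofReal (Real.exp ((1 - α) * (s - r))) := by
    calc _ ≤ ENNReal.ofReal (Real.exp s) ^ (1 - α)
          * ENNReal.ofReal (Real.exp ((α - 1) / α * r)) ^ α := by
          gcongr; exact renyiIntegral_le_of_lt_information hα0 hα h
      _ = _ := by
          rw [ENNReal.ofReal_rpow_of_pos (Real.exp_pos _),
            ENNReal.ofReal_rpow_of_pos (Real.exp_pos _), ← ENNReal.ofReal_mul (by positivity),
            ← Real.exp_mul, ← Real.exp_mul, ← Real.exp_add]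
          congr 2
          field_simp
          ring
  have h3 : (⌈Real.exp ρ⌉₊ : ℝ≥0∞) * (ENNReal.ofReal (Real.exp s))⁻¹
      ≤ ENNReal.ofReal (2 * Real.exp (ρ - s)) := by
    rw [← ENNReal.ofReal_inv_of_pos (Real.exp_pos s), ← ENNReal.ofReal_natCast,
      ← ENNReal.ofReal_mul (by positivity), ← Real.exp_neg, sub_eq_add_neg, Real.exp_add,
      ← mul_assoc]
    refine ENNReal.ofReal_le_ofReal (mul_le_mul_of_nonneg_right ?_ (Real.exp_pos _).le)
    have := Nat.ceil_lt_add_one (Real.exp_pos ρ).le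
    linarith [Real.one_le_exp hρ]
  obtain ⟨c, hM, hL, hc⟩ := exists_code_of_threshold P W hτ ENNReal.ofReal_ne_top
    (δ := ENNReal.ofReal (Real.exp ((1 - α) * (s - r)) + 2 * Real.exp (ρ - s) + e))
    ENNReal.ofReal_ne_top (Nat.ceil_pos.2 (Real.exp_pos ρ))
    (((add_le_add (h1.trans h2) h3).trans_eq
      (ENNReal.ofReal_add (by positivity) (by positivity)).symm).trans_lt
      ((ENNReal.ofReal_lt_ofReal_iff (by positivity)).2 (by linarith)))
  exact ⟨c, hM, hL, hc.trans_eq (ENNReal.toReal_ofReal (by positivity))⟩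

/-- The strong converse for a single channel in exponential form. -/
theorem Code.one_sub_avgError_le_exp (c : Code X Y) (W : Channel X Y) {α r ρ : ℝ} (hα : 1 < α)
    (hr : renyiCapacity α W ≤ r) (hρ : ρ ≤ Real.log (c.M / c.L)) :
    1 - c.avgError W ≤ Real.exp ((α - 1) / α * (r - ρ)) := by
  have hM : (0 : ℝ) < c.M := by exact_mod_cast c.M_pos
  have hL : (0 : ℝ) < c.L := by exact_mod_cast c.L_pos
  have hα0 : 0 < α := by linarith
  have hexp : 1 - 1 / α = (α - 1) / α := by field_simp
  have hLM : (c.L : ℝ≥0∞) * (c.M : ℝ≥0∞)⁻¹ ≤ ENNReal.ofReal (Real.exp (-ρ)) := by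
    rw [← ENNReal.ofReal_natCast, ← ENNReal.ofReal_natCast, ← ENNReal.ofReal_inv_of_pos hM,
      ← ENNReal.ofReal_mul hL.le]
    refine ENNReal.ofReal_le_ofReal ?_
    have h := Real.exp_le_exp.2 (neg_le_neg hρ)
    rwa [Real.exp_neg (Real.log _), Real.exp_log (by positivity), inv_div, div_eq_mul_inv] at h
  have hJ := renyiIntegral_le_of_information_le hα
    ((le_iSup (fun P => renyiInformation α P W) c.inputPMF).trans hr)
  have hpos : 0 ≤ (α - 1) / α := div_nonneg (by linarith) hα0.le
  refine (ENNReal.ofReal_le_ofReal_iff (Real.exp_pos _).le).1 ?_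
  calc ENNReal.ofReal (1 - c.avgError W)
      ≤ ((c.L : ℝ≥0∞) * (c.M : ℝ≥0∞)⁻¹) ^ (1 - 1 / α) * renyiIntegral α c.inputPMF W :=
        c.one_sub_avgError_le W hα
    _ ≤ ENNReal.ofReal (Real.exp (-ρ)) ^ ((α - 1) / α)
        * ENNReal.ofReal (Real.exp ((α - 1) / α * r)) := by
        rw [hexp]
        gcongr
    _ = _ := by
        rw [ENNReal.ofReal_rpow_of_pos (Real.exp_pos _), ← ENNReal.ofReal_mul (by positivity),
          ← Real.exp_mul, ← Real.exp_add]
        congr 2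
        ring

end OneShot

/-! ### Sequences of channels -/

section Sequences

variable {X Y : ℕ → Type*} [∀ n, MeasurableSpace (Y n)] {W : ∀ n, Channel (X n) (Y n)} {t : ℕ → ℝ}

/-- The weak converse: no reliable sequence of codes has a rate above the limit of the scaled
order one capacity. -/
theorem rate_le_of_tendsto_renyiCapacity_one [∀ n, Nonempty (X n)] (ht : Tendsto t atTop atTop)
    {C R : EReal} (hC : Tendsto (fun n => renyiCapacity 1 (W n) / (t n : EReal)) atTop (𝓝 C))
    {c : ∀ n, Code (X n) (Y n)} (hL : ∀ n, (c n).L = 1) (hc : IsReliable W c)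
    (hR : IsOfRate t c R) : R ≤ C := by
  by_contra! hlt
  obtain ⟨a, hCa, haR⟩ := EReal.lt_iff_exists_real_btwn.1 hlt
  obtain ⟨b, hab, hbR⟩ := EReal.lt_iff_exists_real_btwn.1 haR
  have hab' : a < b := EReal.coe_lt_coe_iff.1 hab
  have hrate := eventually_lt_of_lt_liminf (hbR.trans_eq hR.symm)
  have hbound : ∀ᶠ n in atTop, (1 - (c n).avgError (W n)) * b ≤ a + (t n)⁻¹ := by
    filter_upwards [hrate, hC.eventually_lt_const hCa, ht.eventually_gt_atTop 0] with n h1 h2 ht0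
    have h1' : b * t n < Real.log (c n).M := by
      have := EReal.coe_lt_coe_iff.1 h1
      rw [hL n, Nat.cast_one, div_one, one_div, inv_mul_eq_div, lt_div_iff₀ ht0] at this
      exact this
    rw [EReal.div_lt_iff (by exact_mod_cast ht0) (EReal.coe_ne_top _)] at h2
    have h3 : Real.log (c n).M * (1 - (c n).avgError (W n)) ≤ a * t n + 1 := by
      have h4 := (c n).log_mul_one_sub_avgError_le (hL n) (W n)
      have h5 : renyiInformation 1 (c n).inputPMF (W n) ≤ ((a * t n : ℝ) : EReal) :=
        (le_iSup (fun P => renyiInformation 1 P (W n)) _).trans (h2.le.trans_eq (by simp))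
      exact_mod_cast h4.trans (add_le_add_left h5 1)
    have h6 := (c n).avgError_le_one (W n)
    refine le_of_mul_le_mul_right ?_ ht0
    calc (1 - (c n).avgError (W n)) * b * t n = (b * t n) * (1 - (c n).avgError (W n)) := by ring
      _ ≤ Real.log (c n).M * (1 - (c n).avgError (W n)) :=
        mul_le_mul_of_nonneg_right h1'.le (by linarith)
      _ ≤ a * t n + 1 := h3
      _ = (a + (t n)⁻¹) * t n := by field_simp
  have hl : Tendsto (fun n => (1 - (c n).avgError (W n)) * b) atTop (𝓝 ((1 - 0) * b)) :=
    (tendsto_const_nhds.sub hc).mul_const b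
  have hr : Tendsto (fun n => a + (t n)⁻¹) atTop (𝓝 (a + 0)) :=
    tendsto_const_nhds.add ht.inv_tendsto_atTop
  have := le_of_tendsto_of_tendsto hl hr hbound
  linarith

lemma tendsto_exp_const_mul_zero (ht : Tendsto t atTop atTop) {κ : ℝ} (hκ : κ < 0) :
    Tendsto (fun n => Real.exp (κ * t n)) atTop (𝓝 0) :=
  Real.tendsto_exp_atBot.comp (ht.const_mul_atTop_of_neg hκ)

lemma tendsto_log_ceil_exp_div (ht : Tendsto t atTop atTop) {R : ℝ} (hR : 0 ≤ R) :
    Tendsto (fun n => 1 / t n * Real.log ⌈Real.exp (R * t n)⌉₊) atTop (𝓝 R) := by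
  have hupper : Tendsto (fun n => R + Real.log 2 * (t n)⁻¹) atTop (𝓝 R) := by
    simpa using tendsto_const_nhds.add (ht.inv_tendsto_atTop.const_mul (Real.log 2))
  refine tendsto_of_tendsto_of_tendsto_of_le_of_le' tendsto_const_nhds hupper ?_ ?_
  · filter_upwards [ht.eventually_gt_atTop 0] with n ht0
    rw [one_div, inv_mul_eq_div, le_div_iff₀ ht0]
    exact (Real.le_log_iff_exp_le (by positivity)).2 (Nat.le_ceil _)
  · filter_upwards [ht.eventually_gt_atTop 0] with n ht0
    have h1 : (⌈Real.exp (R * t n)⌉₊ : ℝ) ≤ 2 * Real.exp (R * t n) := by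
      have := Nat.ceil_lt_add_one (Real.exp_pos (R * t n)).le
      linarith [Real.one_le_exp (mul_nonneg hR ht0.le)]
    have h2 := Real.log_le_log (by positivity) h1
    rw [Real.log_mul (by norm_num) (Real.exp_ne_zero _), Real.log_exp] at h2
    calc 1 / t n * Real.log ⌈Real.exp (R * t n)⌉₊
        ≤ 1 / t n * (Real.log 2 + R * t n) := by gcongr
      _ = _ := by field_simp; ring

/-- Achievability: every rate below the scaled capacity of some order `α < 1` is the rate of a
reliable sequence of codes. -/
theorem exists_isReliable_isOfRate [∀ n, Nonempty (X n)] (ht : Tendsto t atTop atTop)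
    {α R r : ℝ} (hα0 : 0 < α) (hα : α < 1) (hR : 0 ≤ R) (hRr : R < r)
    (hC : ∀ᶠ n in atTop, (r : EReal) < renyiCapacity α (W n) / (t n : EReal)) :
    ∃ c : ∀ n, Code (X n) (Y n), (∀ n, (c n).L = 1) ∧ IsReliable W c ∧ IsOfRate t c R := by
  obtain ⟨s, hRs, hsr⟩ := exists_between hRr
  set u : ℕ → ℝ := fun n =>
    Real.exp ((1 - α) * (s - r) * t n) + 2 * Real.exp ((R - s) * t n) + Real.exp (-1 * t n)
  have hgood : ∀ᶠ n in atTop, ∃ c : Code (X n) (Y n), c.L = 1 ∧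
      c.M = ⌈Real.exp (R * t n)⌉₊ ∧ c.avgError (W n) ≤ u n := by
    filter_upwards [hC, ht.eventually_gt_atTop 0] with n hn ht0
    rw [EReal.lt_div_iff (by exact_mod_cast ht0) (EReal.coe_ne_top _), renyiCapacity,
      lt_iSup_iff] at hn
    obtain ⟨P, hP⟩ := hn
    obtain ⟨c, hM, hL, hc⟩ := exists_code_of_lt_renyiInformation (r := r * t n) (s * t n) hα0 hα
      (mul_nonneg hR ht0.le) (Real.exp_pos (-1 * t n)) (by simpa using hP)
    refine ⟨c, hL, hM, hc.trans_eq ?_⟩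
    simp only [u]
    ring_nf
  -- at the finitely many exceptional `n` any code will do
  have hex (n : ℕ) : ∃ c : Code (X n) (Y n), c.L = 1 ∧
      ((∃ c : Code (X n) (Y n), c.L = 1 ∧ c.M = ⌈Real.exp (R * t n)⌉₊ ∧
        c.avgError (W n) ≤ u n) → c.M = ⌈Real.exp (R * t n)⌉₊ ∧ c.avgError (W n) ≤ u n) := by
    by_cases h : ∃ c : Code (X n) (Y n), c.L = 1 ∧ c.M = ⌈Real.exp (R * t n)⌉₊ ∧
        c.avgError (W n) ≤ u n
    · obtain ⟨c, hL, hc⟩ := h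
      exact ⟨c, hL, fun _ => hc⟩
    · exact ⟨Code.trivial (Classical.arbitrary _), rfl, fun h' => absurd h' h⟩
  choose c hL hc using hex
  refine ⟨c, hL, ?_, ?_⟩
  · have hu : Tendsto u atTop (𝓝 0) := by
      have h1 := tendsto_exp_const_mul_zero ht (κ := (1 - α) * (s - r))
        (mul_neg_of_pos_of_neg (by linarith) (by linarith))
      have h2 := (tendsto_exp_const_mul_zero ht (κ := R - s) (by linarith)).const_mul 2
      have h3 := tendsto_exp_const_mul_zero ht (κ := -1) (by norm_num)
      simpa [u] using (h1.add h2).add h3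
    refine squeeze_zero' (.of_forall fun n => (c n).avgError_nonneg (W n)) ?_ hu
    filter_upwards [hgood] with n hn using (hc n hn).2
  · refine Tendsto.liminf_eq ((continuous_coe_real_ereal.tendsto R).comp
      ((tendsto_log_ceil_exp_div ht hR).congr' ?_))
    filter_upwards [hgood] with n hn
    rw [(hc n hn).1, hL n, Nat.cast_one, div_one]

lemma channelCapacity_nonneg [∀ n, Nonempty (X n)] : 0 ≤ channelCapacity W t := by
  refine le_sSup ⟨fun n => Code.trivial (Classical.arbitrary _), fun _ => rfl, ?_, ?_⟩
  · simp [IsReliable, Code.avgError_trivial]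
  · simp [IsOfRate, Code.trivial]

/-- The strong converse: the error probability tends to one at rates above the scaled capacity
of some order `α > 1`. -/
theorem tendsto_avgError_one (ht : Tendsto t atTop atTop) {α r : ℝ} {R : EReal} (hα : 1 < α)
    (hrR : r < R) (hC : ∀ᶠ n in atTop, renyiCapacity α (W n) / (t n : EReal) < r)
    {c : ∀ n, Code (X n) (Y n)} (hR : IsOfRate t c R) :
    Tendsto (fun n => (c n).avgError (W n)) atTop (𝓝 1) := by
  obtain ⟨b, hrb, hbR⟩ := EReal.lt_iff_exists_real_btwn.1 hrR
  have hrb' : r < b := EReal.coe_lt_coe_iff.1 hrb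
  have hrate := eventually_lt_of_lt_liminf (hbR.trans_eq hR.symm)
  have hlim : Tendsto (fun n => 1 - Real.exp ((α - 1) / α * (r - b) * t n)) atTop (𝓝 1) := by
    simpa using (tendsto_exp_const_mul_zero ht (κ := (α - 1) / α * (r - b))
      (mul_neg_of_pos_of_neg (div_pos (by linarith) (by linarith)) (by linarith))).const_sub 1
  refine tendsto_of_tendsto_of_tendsto_of_le_of_le' hlim tendsto_const_nhds ?_
    (.of_forall fun n => (c n).avgError_le_one (W n))
  filter_upwards [hrate, hC, ht.eventually_gt_atTop 0] with n h1 h2 ht0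
  have h1' : b * t n ≤ Real.log ((c n).M / (c n).L) := by
    have := EReal.coe_lt_coe_iff.1 h1
    rw [one_div, inv_mul_eq_div, lt_div_iff₀ ht0] at this
    exact this.le
  rw [EReal.div_lt_iff (by exact_mod_cast ht0) (EReal.coe_ne_top _)] at h2
  have h3 := (c n).one_sub_avgError_le_exp (W n) (r := r * t n) hα (by simpa using h2.le) h1'
  rw [← sub_mul, ← mul_assoc] at h3
  linarith

end Sequences

end ChannelCoding

theorem mainTheorem6 {X Y : ℕ → Type*} [∀ n, Nonempty (X n)] [∀ n, MeasurableSpace (Y n)]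
    (W : ∀ n, ChannelCoding.Channel (X n) (Y n)) (t : ℕ → ℝ) (ht : Tendsto t atTop atTop) :
    (∀ (ε : ℝ) (η : ℝ → EReal), 0 < ε → ε < 1 →
      LowerSemicontinuousOn η (Icc (1 - ε) 1) →
      (∀ α ∈ Icc (1 - ε) 1,
        Tendsto (fun n => ChannelCoding.renyiCapacity α (W n) / (t n : EReal)) atTop
          (𝓝 (η α))) →
      ChannelCoding.channelCapacity W t = η 1) ∧
    (∀ (ε : ℝ) (η : ℝ → EReal), 0 < ε →
      UpperSemicontinuousOn η (Icc 1 (1 + ε)) →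
      η (1 + ε) < ⊤ →
      (∀ α ∈ Icc 1 (1 + ε),
        limsup (fun n => ChannelCoding.renyiCapacity α (W n) / (t n : EReal)) atTop = η α) →
      ∀ (R : EReal) (c : ∀ n, ChannelCoding.Code (X n) (Y n)),
        η 1 < R → ChannelCoding.IsOfRate t c R →
        Tendsto (fun n => (c n).avgError (W n)) atTop (𝓝 1)) := by
  refine ⟨fun ε η hε hε1 hη hlim => ?_, fun ε η hε hη _ hlim R c hR hc => ?_⟩
  · have h1 : (1 : ℝ) ∈ Icc (1 - ε) 1 := ⟨by linarith, le_rfl⟩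
    refine le_antisymm (sSup_le ?_) (le_of_forall_lt fun a ha => ?_)
    · rintro R ⟨c, hL, hc, hR⟩
      exact ChannelCoding.rate_le_of_tendsto_renyiCapacity_one ht (hlim 1 h1) hL hc hR
    · rcases lt_or_ge a 0 with ha0 | ha0
      · exact ha0.trans_le ChannelCoding.channelCapacity_nonneg
      obtain ⟨R, haR, hR⟩ := EReal.lt_iff_exists_real_btwn.1 ha
      obtain ⟨r, hRr, hr⟩ := EReal.lt_iff_exists_real_btwn.1 hR
      have hev := (hη 1 h1 r hr).filter_mono (nhdsWithin_mono 1 Ioo_subset_Icc_self)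
      -- lower semicontinuity supplies an order below one whose limit still exceeds `r`
      obtain ⟨α, hrα, hα⟩ : ∃ α, r < η α ∧ α ∈ Ioo (1 - ε) 1 := by
        have : (𝓝[Ioo (1 - ε) 1] (1 : ℝ)).NeBot := by
          rw [nhdsWithin_Ioo_eq_nhdsLT (by linarith)]
          infer_instance
        exact (hev.and self_mem_nhdsWithin).exists
      have hR0 : 0 ≤ R := by exact_mod_cast ha0.trans haR.le
      exact haR.trans_le <| le_sSup <| ChannelCoding.exists_isReliable_isOfRate ht
        (by linarith [hα.1]) hα.2 hR0 (EReal.coe_lt_coe_iff.1 hRr)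
        ((hlim α (Ioo_subset_Icc_self hα)).eventually_const_lt hrα)
  · have h1 : (1 : ℝ) ∈ Icc 1 (1 + ε) := ⟨le_rfl, by linarith⟩
    obtain ⟨r, hηr, hrR⟩ := EReal.lt_iff_exists_real_btwn.1 hR
    have hev := (hη 1 h1 r hηr).filter_mono (nhdsWithin_mono 1 Ioo_subset_Icc_self)
    -- upper semicontinuity supplies an order above one whose upper limit is still below `r`
    obtain ⟨α, hrα, hα⟩ : ∃ α, η α < r ∧ α ∈ Ioo 1 (1 + ε) := by
      have : (𝓝[Ioo 1 (1 + ε)] (1 : ℝ)).NeBot := by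
        rw [nhdsWithin_Ioo_eq_nhdsGT (by linarith)]
        infer_instance
      exact (hev.and self_mem_nhdsWithin).exists
    exact ChannelCoding.tendsto_avgError_one ht hα.1 hrR
      (eventually_lt_of_limsup_lt ((hlim α (Ioo_subset_Icc_self hα)).trans_lt hrα)) hc
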